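/- Let $p,q\ge 2$. Let $T_p$ and $T_q$ be the regular trees of degrees $p+1$ and $q+1$, and for $i=p,q$ choose a root $o_i\in T_i$ and an end $\omega_i$ of $T_i$ (a class of rays, i.e. one-way infinite paths without repeated vertices, where two rays are equivalent if they coincide after deleting a finite initial part of each). Let $h_i\colon T_i\to\mathbb Z$, $h_i(x)=\lim_{n\to\infty}\bigl(d(x,\gamma_n)-d(o_i,\gamma_n)\bigr)$ for any ray $\gamma\in\omega_i$, be the associated height (Busemann) function. The Diestel–Leader graph $\mathrm{DL}(p,q)$ has vertex set $\{xy=(x,y)\in T_p\times T_q : h_p(x)+h_q(y)=0\}$, and $xy$ is adjacent to $x'y'$ if and only if $x$ is adjacent to $x'$ in $T_p$ and $y$ is adjacent to $y'$ in $T_q$. Then $X=\mathrm{DL}(p,q)$ has infinite motion: every non-identity automorphism of $X$ moves infinitely many vertices. Moreover, the stabilizer of the base vertex $o_po_q$ in $\mathrm{Aut}(X)$ has infinite geometric motion: every automorphism $f\ne\mathrm{id}$ of $X$ that fixes $o_po_q$ satisfies $\sup_{v\in X} d(v,f(v))=\infty$. Furthermore, $X$ is connected, locally finite and of symmetric growth,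 that is, there are $k,l,m\in\mathbb N$ such that $|D(x,r)|\le k\,|D(y,lr)|$ for all vertices $x,y$ and all $r\ge m$, where $D(x,r)$ is the set of vertices at distance at most $r$ from $x$. Finally, the distinguishing number of $X$ is at most $2$: there is a coloring of the vertices of $X$ by at most two colors that is preserved by no automorphism other than the identity. -/

import Mathlib

open Filter

/-! ### Motion, geometric motion, colorings and growth of a graph -/

namespace SimpleGraph

universe u

variable {V : Type u}

/-- The motion `m(f)` of an automorphism: the number of vertices that it moves (`⊤` if infinite). -/
noncomputable def autMotion {G : SimpleGraph V} (f : G ≃g G) : ℕ∞ :=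
  {x : V | f x ≠ x}.encard

/-- The motion of a set of automorphisms: the infimum of the motions of its non-identity
elements. -/
noncomputable def motion {G : SimpleGraph V} (A : Set (G ≃g G)) : ℕ∞ :=
  ⨅ f ∈ {f : G ≃g G | f ∈ A ∧ f ≠ 1}, autMotion f

/-- The geometric motion of an automorphism: the supremum of its displacements `d(x, f x)`. -/
noncomputable def autGeometricMotion {G : SimpleGraph V} (f : G ≃g G) : ℕ∞ :=
  ⨆ x : V, G.edist x (f x)

/-- The geometric motion of a set of automorphisms: the infimum of the geometric motions of its
non-identity elements. It is infinite iff every non-identity element of the set has infinite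
geometric motion, i.e. is not close to the identity. -/
noncomputable def geometricMotion {G : SimpleGraph V} (A : Set (G ≃g G)) : ℕ∞ :=
  ⨅ f ∈ {f : G ≃g G | f ∈ A ∧ f ≠ 1}, autGeometricMotion f

/-- The stabilizer `S_x` of a vertex `x` in `Aut(G)`. -/
def vertexStabilizer (G : SimpleGraph V) (x : V) : Set (G ≃g G) :=
  {f | f x = x}

/-- A (not necessarily proper) vertex coloring is distinguishing if the identity is the only
automorphism that preserves it. -/
def IsDistinguishing (G : SimpleGraph V) {C : Type*} (φ : V → C) : Prop :=
  ∀ f : G ≃g G, (∀ x, φ (f x) = φ x) → f = 1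

/-- The distinguishing number `D(G)`: the least number of colors of a distinguishing coloring
(`⊤` if finitely many colors do not suffice). -/
noncomputable def distinguishingNumber (G : SimpleGraph V) : ℕ∞ :=
  ⨅ k ∈ {k : ℕ | ∃ φ : V → Fin k, G.IsDistinguishing φ}, (k : ℕ∞)

/-- The growth function `β_x(r) = |D(x, r)|`, the number of vertices at distance at most `r`
from `x`. -/
noncomputable def growth (G : SimpleGraph V) (x : V) (r : ℕ) : ℕ∞ :=
  {y : V | G.edist y x ≤ r}.encard

/-- Symmetric growth: the growth functions at all vertices dominate one another with uniform
constants. -/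
def SymmetricGrowth (G : SimpleGraph V) : Prop :=
  ∃ k l m : ℕ, ∀ r : ℕ, m ≤ r → ∀ x y : V, G.growth x r ≤ k * G.growth y (l * r)

/-! ### Ends of trees and Busemann functions -/

/-- A geodesic ray. In a tree these are exactly the rays (one-way infinite paths without repeated
vertices). -/
structure GeodesicRay (T : SimpleGraph V) where
  /-- The vertices of the ray. -/
  vert : ℕ → V
  /-- The ray is geodesic. -/
  dist_vert : ∀ n k : ℕ, T.dist (vert n) (vert (n + k)) = k

/-- Two rays are cofinal if they coincide after deleting a finite initial part of each. -/
instance GeodesicRay.cofinalSetoid (T : SimpleGraph V) : Setoid T.GeodesicRay where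
  r γ δ := ∃ m n : ℕ, ∀ k : ℕ, γ.vert (m + k) = δ.vert (n + k)
  iseqv := by
    refine ⟨fun γ => ⟨0, 0, fun k => rfl⟩, ?_, ?_⟩
    · rintro γ δ ⟨m, n, h⟩
      exact ⟨n, m, fun k => (h k).symm⟩
    · rintro γ δ ε ⟨m, n, h⟩ ⟨m', n', h'⟩
      refine ⟨m + m', n' + n, fun k => ?_⟩
      have h1 := h (m' + k)
      have h2 := h' (n + k)
      rw [show m + m' + k = m + (m' + k) by omega, h1,
        show n + (m' + k) = m' + (n + k) by omega, h2,
        show n' + (n + k) = n' + n + k by omega]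

/-- The ends of a tree `T`: the classes of cofinal rays. -/
def TreeEnd (T : SimpleGraph V) : Type u :=
  Quotient (GeodesicRay.cofinalSetoid T)

/-- The height (Busemann function) with respect to the root `o` and an end `ω` of the tree `T`:
`h(x) = lim_n (d(x, γ n) - d(o, γ n))` for any ray `γ` in the class `ω`. The sequence is
eventually constant, see `eventually_eq_busemann`. -/
noncomputable def busemann (T : SimpleGraph V) (o : V) (ω : T.TreeEnd) (x : V) : ℤ :=
  Quotient.lift
    (fun γ : T.GeodesicRay =>
      limUnder atTop (fun n : ℕ => (T.dist x (γ.vert n) : ℤ) - (T.dist o (γ.vert n) : ℤ)))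
    (by
      rintro γ δ ⟨m, n, h⟩
      have key : ∀ (f : ℕ → ℤ) (a : ℕ),
          limUnder atTop f = limUnder atTop (fun k => f (a + k)) := by
        intro f a
        unfold limUnder
        conv_lhs => rw [← map_add_atTop_eq_nat a]
        rw [Filter.map_map]
        congr 2
        funext k
        simp [add_comm]
      rw [key _ m, key (fun k => (T.dist x (δ.vert k) : ℤ) - (T.dist o (δ.vert k) : ℤ)) n]
      simp only [h])
    ω

/-- In a connected graph (in particular in a tree), the sequence that defines the Busemann
function is eventually constant, so that its limit exists. -/
theorem eventually_eq_busemann {T : SimpleGraph V} (hT : T.Connected) (o : V)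
    (γ : T.GeodesicRay) (x : V) :
    ∀ᶠ n : ℕ in atTop, (T.dist x (γ.vert n) : ℤ) - (T.dist o (γ.vert n) : ℤ) =
      T.busemann o (Quotient.mk _ γ) x := by
  have h0 : ∀ n, T.dist (γ.vert 0) (γ.vert n) = n := fun n => by
    simpa using γ.dist_vert 0 n
  have ev : ∀ z : V, ∃ c : ℤ, ∀ᶠ n : ℕ in atTop, (T.dist z (γ.vert n) : ℤ) - n = c := by
    intro z
    have anti : Antitone (fun n : ℕ => T.dist z (γ.vert n) + T.dist z (γ.vert 0) - n) := by
      refine antitone_nat_of_succ_le fun n => ?_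
      have h1 := hT.dist_triangle (u := z) (v := γ.vert n) (w := γ.vert (n + 1))
      rw [γ.dist_vert n 1] at h1
      omega
    have bd : ∀ n : ℕ, n ≤ T.dist z (γ.vert n) + T.dist z (γ.vert 0) := by
      intro n
      have h1 := hT.dist_triangle (u := γ.vert 0) (v := z) (w := γ.vert n)
      rw [h0, T.dist_comm (u := γ.vert 0)] at h1
      omega
    obtain ⟨N, hN⟩ := WellFoundedLT.antitone_chain_condition anti
    refine ⟨(T.dist z (γ.vert N) : ℤ) - N, eventually_atTop.2 ⟨N, fun n hn => ?_⟩⟩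
    have h1 := hN n hn
    have h2 := bd n
    have h3 := bd N
    omega
  obtain ⟨c, hc⟩ := ev x
  obtain ⟨c', hc'⟩ := ev o
  have hev : ∀ᶠ n : ℕ in atTop,
      (T.dist x (γ.vert n) : ℤ) - (T.dist o (γ.vert n) : ℤ) = c - c' := by
    filter_upwards [hc, hc'] with n h1 h2
    omega
  have hlim : T.busemann o (Quotient.mk _ γ) x = c - c' :=
    (tendsto_const_nhds.congr' (hev.mono fun _ h => h.symm)).limUnder_eq
  rw [hlim]
  exact hev

theorem busemann_root (T : SimpleGraph V) (o : V) (ω : T.TreeEnd) : T.busemann o ω o = 0 := by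
  induction ω using Quotient.inductionOn with
  | h γ =>
    change limUnder atTop _ = 0
    simp only [sub_self]
    exact tendsto_const_nhds.limUnder_eq

end SimpleGraph

/-! ### Diestel–Leader graphs -/

/-- The vertices of the Diestel–Leader graph: the pairs of vertices of the two trees whose heights
add up to zero. -/
def DLVertex {V W : Type*} (T : SimpleGraph V) (o : V) (ω : T.TreeEnd)
    (T' : SimpleGraph W) (o' : W) (ω' : T'.TreeEnd) : Type _ :=
  {z : V × W // T.busemann o ω z.1 + T'.busemann o' ω' z.2 = 0}

/-- The Diestel–Leader graph of two trees with chosen roots and ends: `xy` and `x'y'` are adjacent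
iff `x, x'` are adjacent in `T` and `y, y'` are adjacent in `T'`. It is `DL(p,q)` if `T` and `T'`
are the regular trees of degrees `p + 1` and `q + 1`. -/
def DLGraph {V W : Type*} (T : SimpleGraph V) (o : V) (ω : T.TreeEnd)
    (T' : SimpleGraph W) (o' : W) (ω' : T'.TreeEnd) :
    SimpleGraph (DLVertex T o ω T' o' ω') where
  Adj z z' := T.Adj z.1.1 z'.1.1 ∧ T'.Adj z.1.2 z'.1.2
  symm := ⟨fun _ _ h => ⟨h.1.symm, h.2.symm⟩⟩
  loopless := ⟨fun _ h => T.loopless.irrefl _ h.1⟩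

/-- The base vertex, the pair of the two roots. -/
def DLBase {V W : Type*} (T : SimpleGraph V) (o : V) (ω : T.TreeEnd)
    (T' : SimpleGraph W) (o' : W) (ω' : T'.TreeEnd) : DLVertex T o ω T' o' ω' :=
  ⟨(o, o'), by simp [SimpleGraph.busemann_root]⟩

/-! An end turns a regular tree into a `HoroTree`: each vertex has one parent, towards the end, and
`p` children. As heights add up to zero, every edge of the Diestel–Leader graph goes to a child in
one tree and to the parent in the other, so edges are oriented (`Up`). The orientation can be read
off locally from common neighbors, so an automorphism preserves it everywhere or reverses it
everywhere (`preserves_or_reverses`). If it is preserved, the automorphism is a pair of tree maps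
that commute with parents and shift heights by constants. If it is reversed, the same holds after
exchanging the coordinates; hence `UpIso` allows different trees at source and target.

Geometric motion: for an orientation-preserving `f` with a fixed vertex the shifts vanish. If a tree
map moves `v`, then vertices `N` generations below `v` are moved by at least `N`. An
orientation-reversing `f` essentially negates heights, so it moves vertices of large height far.
Infinite motion follows: moving only finitely many vertices would bound the displacement.

Distinguishing: in each tree a vertex with index `i` gets exactly `i` black children, so a map that
respects parents and colors respects indices, and is the identity if it also fixes heights. The
graph only shows the sum of the two colors, plus the indicator of nonnegative height. Each height
contains vertices whose color provably does not change, which separates the summands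
(`color_map_eq`); what remains forces the indicator to be invariant, which excludes shifts and
reversals. -/

/-! ### Trees with a distinguished end, in terms of parents and heights -/

/-- A `p`-ary tree hanging down from an end: a set of vertices with a height function `h`, where
every vertex has a parent of height one less, and `p` children numbered by `Fin p`, and where any
two vertices have a common ancestor. -/
structure HoroTree {V : Type*} (h : V → ℤ) (p : ℕ) where
  /-- The neighbor in the direction of the end. -/
  parent : V → V
  /-- The children. -/
  child : V → Fin p → V
  /-- The position of a vertex among its siblings. -/
  idx : V → Fin p
  two_le : 2 ≤ p
  parent_child : ∀ v i, parent (child v i) = v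
  idx_child : ∀ v i, idx (child v i) = i
  child_idx : ∀ v, child (parent v) (idx v) = v
  height_parent : ∀ v, h (parent v) = h v - 1
  confluent : ∀ x y, ∃ m n : ℕ, parent^[m] x = parent^[n] y
  nonempty : Nonempty V

namespace HoroTree

variable {V : Type*} {h : V → ℤ} {p : ℕ} (A : HoroTree h p)

/-- The first child. -/
def firstChild (v : V) : V := A.child v ⟨0, by have := A.two_le; omega⟩

theorem parent_firstChild (v : V) : A.parent (A.firstChild v) = v := A.parent_child _ _

theorem height_child (v : V) (i : Fin p) : h (A.child v i) = h v + 1 := by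
  have := A.height_parent (A.child v i)
  rw [A.parent_child] at this
  omega

theorem height_firstChild (v : V) : h (A.firstChild v) = h v + 1 := A.height_child _ _

theorem height_parent_iterate (n : ℕ) (v : V) : h (A.parent^[n] v) = h v - n := by
  induction n with
  | zero => simp
  | succ n ih => rw [Function.iterate_succ_apply', A.height_parent, ih]; push_cast; ring

theorem parent_iterate_firstChild_iterate (n : ℕ) (v : V) :
    A.parent^[n] (A.firstChild^[n] v) = v :=
  Function.LeftInverse.iterate A.parent_firstChild n v

theorem height_firstChild_iterate (n : ℕ) (v : V) : h (A.firstChild^[n] v) = h v + n := by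
  have := A.height_parent_iterate n (A.firstChild^[n] v)
  rw [A.parent_iterate_firstChild_iterate] at this
  omega

theorem exists_height_eq (A : HoroTree h p) (k : ℤ) : ∃ v, h v = k := by
  obtain ⟨o⟩ := A.nonempty
  rcases le_total (h o) k with hk | hk
  · refine ⟨A.firstChild^[(k - h o).toNat] o, ?_⟩
    rw [A.height_firstChild_iterate]; omega
  · refine ⟨A.parent^[(h o - k).toNat] o, ?_⟩
    rw [A.height_parent_iterate]; omega

theorem exists_common_ancestor {x y : V} (hxy : h x = h y) :
    ∃ n : ℕ, A.parent^[n] x = A.parent^[n] y := by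
  obtain ⟨m, n, hmn⟩ := A.confluent x y
  have h1 := congrArg h hmn
  rw [A.height_parent_iterate, A.height_parent_iterate] at h1
  obtain rfl : m = n := by omega
  exact ⟨m, hmn⟩

theorem exists_sibling (v : V) : ∃ w, w ≠ v ∧ A.parent w = A.parent v := by
  have : Nontrivial (Fin p) := Fin.nontrivial_iff_two_le.2 A.two_le
  obtain ⟨j, hj⟩ := exists_ne (A.idx v)
  refine ⟨A.child (A.parent v) j, fun hv => hj ?_, A.parent_child _ _⟩
  rw [← hv, A.idx_child]

theorem ext_idx {v w : V} (h1 : A.parent v = A.parent w) (h2 : A.idx v = A.idx w) : v = w := by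
  rw [← A.child_idx v, h1, h2, A.child_idx]

/-- A walk of length `L`, each step of which goes to the parent or to a child, connects vertices
whose common ancestor is at total distance at most `L`. -/
theorem exists_iterate_of_walk {X : Type*} {G : SimpleGraph X} (π : X → V)
    (hπ : ∀ z w, G.Adj z w → A.parent (π z) = π w ∨ A.parent (π w) = π z) {z w : X}
    (r : G.Walk z w) :
    ∃ a b : ℕ, a ≤ r.length ∧ b ≤ r.length ∧ A.parent^[a] (π z) = A.parent^[b] (π w) := by
  induction r with
  | nil => exact ⟨0, 0, le_rfl, le_rfl, rfl⟩
  | @cons u v w huv r ih =>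
    obtain ⟨a, b, ha, hb, hab⟩ := ih
    rw [SimpleGraph.Walk.length_cons]
    rcases hπ _ _ huv with h1 | h1
    · exact ⟨a + 1, b, by omega, by omega, by rw [Function.iterate_succ_apply, h1, hab]⟩
    · refine ⟨a, b + 1, by omega, by omega, ?_⟩
      rw [← h1, ← Function.iterate_succ_apply, Function.iterate_succ_apply', hab,
        ← Function.iterate_succ_apply' A.parent]

/-- The color of a vertex: black if its index is less than that of its parent. Thus the number of
black children of a vertex is its index. -/
def color (v : V) : ZMod 2 := if A.idx v < A.idx (A.parent v) then 1 else 0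

/-- The child numbered `i` is black exactly when `i < A.idx v`. This is how colors determine
indices. -/
theorem ncard_black_children (v : V) :
    {u | A.parent u = v ∧ A.color u = 1}.ncard = A.idx v := by
  have : {u | A.parent u = v ∧ A.color u = 1} = A.child v '' (Set.Iio (A.idx v)) := by
    ext u
    simp only [Set.mem_ofPred_eq, Set.mem_image, Set.mem_Iio]
    constructor
    · rintro ⟨rfl, hu⟩
      refine ⟨A.idx u, ?_, A.child_idx u⟩
      by_contra hlt
      simp [color, hlt] at hu
    · rintro ⟨i, hi, rfl⟩
      refine ⟨A.parent_child _ _, ?_⟩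
      rw [color, A.parent_child, A.idx_child, if_pos hi]
  rw [this, Set.ncard_image_of_injective]
  · rw [← Finset.coe_Iio, Set.ncard_coe_finset, Fin.card_Iio]
  · intro i j hij
    rw [← A.idx_child v i, hij, A.idx_child]

/-! ### Maps between trees that commute with parents -/

section Map

variable {V' : Type*} {h' : V' → ℤ} {p' : ℕ} {A' : HoroTree h' p'} {g : V → V'}

theorem map_parent_iterate (hg : ∀ v, g (A.parent v) = A'.parent (g v)) (n : ℕ) (v : V) :
    g (A.parent^[n] v) = A'.parent^[n] (g v) :=
  Function.Semiconj.iterate_right (f := g) hg n v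

/-- A map that respects parents shifts the height by a constant. -/
theorem exists_shift (hg : ∀ v, g (A.parent v) = A'.parent (g v)) :
    ∃ k : ℤ, ∀ v, h' (g v) = h v + k := by
  obtain ⟨o⟩ := A.nonempty
  refine ⟨h' (g o) - h o, fun v => ?_⟩
  obtain ⟨m, n, hmn⟩ := A.confluent v o
  have h1 := congrArg h hmn
  have h2 := congrArg (fun u => h' (g u)) hmn
  simp only [map_parent_iterate A hg, height_parent_iterate] at h1 h2
  omega

/-- A map that is onto on the children of each vertex preserves the colors
as soon as it changes them by amounts that depend only on the height. -/
theorem color_map_eq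
    (hsurj : ∀ v u', A'.parent u' = g v → ∃ u, A.parent u = v ∧ g u = u')
    (hc : ∀ v w, h v = h w → A'.color (g v) - A.color v = A'.color (g w) - A.color w) (v : V) :
    A'.color (g v) = A.color v := by
  -- A vertex `u` at the height of `v` is wanted with both `u` and `g u` white. All children of `w`
  -- are white since `w` has index 0; the last child of `g w` is white since no index exceeds the
  -- last one. So `u` is a child of `w` over that last child.
  set w := A.firstChild (A.parent (A.parent v)) with hw
  have hwv : h w = h v - 1 := by
    rw [hw, A.height_firstChild, A.height_parent, A.height_parent]; ring
  have hp := A'.two_le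
  obtain ⟨u, hu, hgu⟩ := hsurj w (A'.child (g w) ⟨p' - 1, by omega⟩) (A'.parent_child _ _)
  have h1 : A'.color (g u) = 0 := by
    rw [hgu, color, A'.parent_child, A'.idx_child, if_neg]
    rw [not_lt, Fin.le_def]
    have := (A'.idx (g w)).2
    simp only; omega
  have h2 : A.color u = 0 := by
    rw [color, hu, hw, firstChild, A.idx_child, if_neg]
    rw [not_lt, Fin.le_def]
    exact Nat.zero_le _
  have h3 := A.height_parent u
  rw [hu] at h3
  have := hc v u (by omega)
  rw [h1, h2, sub_self, sub_eq_zero] at this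
  exact this

/-- A map that respects parents and colors, and that is bijective on the children of each vertex,
respects the indices. -/
theorem idx_map_eq (hg : ∀ v, g (A.parent v) = A'.parent (g v))
    (hsurj : ∀ v u', A'.parent u' = g v → ∃ u, A.parent u = v ∧ g u = u')
    (hinj : ∀ u w, A.parent u = A.parent w → g u = g w → u = w)
    (hc : ∀ v, A'.color (g v) = A.color v) (v : V) : (A'.idx (g v) : ℕ) = A.idx v := by
  rw [← ncard_black_children, ← ncard_black_children]
  have : {u | A'.parent u = g v ∧ A'.color u = 1} = g '' {u | A.parent u = v ∧ A.color u = 1} := by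
    ext u'
    constructor
    · rintro ⟨h1, h2⟩
      obtain ⟨u, hu, rfl⟩ := hsurj v u' h1
      exact ⟨u, ⟨hu, by rw [← hc, h2]⟩, rfl⟩
    · rintro ⟨u, ⟨rfl, hu⟩, rfl⟩
      exact ⟨(hg u).symm, by rw [hc, hu]⟩
  rw [this, Set.InjOn.ncard_image]
  rintro u ⟨hu, -⟩ w ⟨hw, -⟩
  exact hinj u w (hu.trans hw.symm)

end Map

/-- A map of a tree to itself that respects heights, parents and indices is the identity. -/
theorem map_eq_self {g : V → V} (hg : ∀ v, g (A.parent v) = A.parent (g v))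
    (hh : ∀ v, h (g v) = h v) (hi : ∀ v, A.idx (g v) = A.idx v) (v : V) : g v = v := by
  -- The common ancestor at distance `n` is a fixed point; being fixed then descends to `v`, one
  -- generation at a time, through the indices.
  obtain ⟨n, hn⟩ := A.exists_common_ancestor (hh v)
  induction n generalizing v with
  | zero => exact hn
  | succ n ih =>
    rw [Function.iterate_succ_apply, Function.iterate_succ_apply, ← hg] at hn
    exact A.ext_idx (by rw [← hg, ih _ hn]) (hi v)

end HoroTree

/-! ### Horocyclic products -/

/-- The pairs of vertices of opposite heights. -/
abbrev HoroPair {V W : Type*} (h : V → ℤ) (k : W → ℤ) : Type _ :=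
  {z : V × W // h z.1 + k z.2 = 0}

namespace HoroPair

/-- Exchange of the coordinates. -/
def swap {V W : Type*} {h : V → ℤ} {k : W → ℤ} : HoroPair h k ≃ HoroPair k h where
  toFun z := ⟨(z.1.2, z.1.1), by have := z.2; simp only; omega⟩
  invFun z := ⟨(z.1.2, z.1.1), by have := z.2; simp only; omega⟩
  left_inv _ := rfl
  right_inv _ := rfl

end HoroPair

namespace HoroTree

section Product

variable {V W : Type*} {h : V → ℤ} {k : W → ℤ} {p q : ℕ} (A : HoroTree h p) (B : HoroTree k q)

/-- `w` is reached from `z` by going to a child in the first tree and to the parent in the second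
one. -/
def Up (z w : HoroPair h k) : Prop :=
  A.parent w.1.1 = z.1.1 ∧ B.parent z.1.2 = w.1.2

/-- The horocyclic product of two trees. -/
def horoProduct : SimpleGraph (HoroPair h k) where
  Adj z w := A.Up B z w ∨ A.Up B w z
  symm := ⟨fun _ _ => Or.symm⟩
  loopless := ⟨fun z hz => by
    have h1 : A.parent z.1.1 = z.1.1 := by rcases hz with hz | hz <;> exact hz.1
    have h2 := A.height_parent z.1.1
    rw [h1] at h2
    omega⟩

variable {A B}

theorem Up.adj {z w : HoroPair h k} (hzw : A.Up B z w) : (A.horoProduct B).Adj z w := Or.inl hzw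

theorem Up.adj_symm {z w : HoroPair h k} (hzw : A.Up B z w) : (A.horoProduct B).Adj w z :=
  Or.inr hzw

theorem Up.height {z w : HoroPair h k} (hzw : A.Up B z w) : h w.1.1 = h z.1.1 + 1 := by
  have := A.height_parent w.1.1
  rw [hzw.1] at this
  omega

theorem Up.not_symm {z w : HoroPair h k} (hzw : A.Up B z w) : ¬ A.Up B w z := fun hwz => by
  have := hzw.height
  have := hwz.height
  omega

theorem Up.swap {z w : HoroPair h k} (hzw : A.Up B z w) :
    B.Up A (HoroPair.swap w) (HoroPair.swap z) := ⟨hzw.2, hzw.1⟩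

variable (A B)

/-- The neighbor given by the `i`-th child in the first tree. -/
def upChild (z : HoroPair h k) (i : Fin p) : HoroPair h k :=
  ⟨(A.child z.1.1 i, B.parent z.1.2), by
    have := z.2
    simp only [A.height_child, B.height_parent]; omega⟩

theorem up_upChild (z : HoroPair h k) (i : Fin p) : A.Up B z (A.upChild B z i) :=
  ⟨A.parent_child _ _, rfl⟩

/-- The neighbor given by the `j`-th child in the second tree. -/
def downChild (z : HoroPair h k) (j : Fin q) : HoroPair h k :=
  ⟨(A.parent z.1.1, B.child z.1.2 j), by
    have := z.2
    simp only [B.height_child, A.height_parent]; omega⟩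

theorem up_downChild (z : HoroPair h k) (j : Fin q) : A.Up B (A.downChild B z j) z :=
  ⟨rfl, B.parent_child _ _⟩

theorem exists_up (z : HoroPair h k) : ∃ w, A.Up B z w :=
  ⟨_, A.up_upChild B z ⟨0, by have := A.two_le; omega⟩⟩

theorem exists_down (z : HoroPair h k) : ∃ w, A.Up B w z :=
  ⟨_, A.up_downChild B z ⟨0, by have := B.two_le; omega⟩⟩

variable {A B}

theorem Up.exists_eq_upChild {z w : HoroPair h k} (hzw : A.Up B z w) : ∃ i, w = A.upChild B z i :=
  ⟨A.idx w.1.1, Subtype.ext (Prod.ext (by simp [upChild, ← hzw.1, A.child_idx]) hzw.2.symm)⟩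

theorem Up.exists_eq_downChild {z w : HoroPair h k} (hzw : A.Up B w z) :
    ∃ j, w = A.downChild B z j :=
  ⟨B.idx w.1.2, Subtype.ext (Prod.ext hzw.1.symm (by simp [downChild, ← hzw.2, B.child_idx]))⟩

variable (A B)

theorem exists_fst_eq (B : HoroTree k q) (h : V → ℤ) (x : V) : ∃ z : HoroPair h k, z.1.1 = x := by
  obtain ⟨y, hy⟩ := B.exists_height_eq (-h x)
  exact ⟨⟨(x, y), by simp [hy]⟩, rfl⟩

theorem adj_fst {z w : HoroPair h k} (hzw : (A.horoProduct B).Adj z w) :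
    A.parent z.1.1 = w.1.1 ∨ A.parent w.1.1 = z.1.1 := by
  rcases hzw with h1 | h1
  · exact Or.inr h1.1
  · exact Or.inl h1.1

/-! #### Connectedness -/

theorem reachable_down (n : ℕ) (z : HoroPair h k) :
    ∃ w, (A.horoProduct B).Reachable z w ∧ w.1.1 = A.parent^[n] z.1.1 := by
  induction n generalizing z with
  | zero => exact ⟨z, .rfl, rfl⟩
  | succ n ih =>
    obtain ⟨z', hz'⟩ := A.exists_down B z
    obtain ⟨w, hw, hw'⟩ := ih z'
    exact ⟨w, hz'.adj_symm.reachable.trans hw, by rw [hw', ← hz'.1, Function.iterate_succ_apply]⟩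

/-- Taking the same child in the first tree from both vertices keeps the first coordinates equal and
replaces the second ones by their parents, which agree after `n` steps. -/
theorem reachable_of_fst_eq (n : ℕ) (z w : HoroPair h k) (hzw : z.1.1 = w.1.1)
    (hn : B.parent^[n] z.1.2 = B.parent^[n] w.1.2) : (A.horoProduct B).Reachable z w := by
  induction n generalizing z w with
  | zero =>
    obtain rfl : z = w := Subtype.ext (Prod.ext hzw hn)
    exact .rfl
  | succ n ih =>
    have i : Fin p := ⟨0, by have := A.two_le; omega⟩
    exact (A.up_upChild B z i).adj.reachable.trans <|
      (ih _ _ (by simp [upChild, hzw]) (by simpa [upChild] using hn)).trans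
        (A.up_upChild B w i).adj_symm.reachable

theorem horoProduct_connected : (A.horoProduct B).Connected where
  preconnected z w := by
    obtain ⟨m, n, hmn⟩ := A.confluent z.1.1 w.1.1
    obtain ⟨z', hz, hz'⟩ := A.reachable_down B m z
    obtain ⟨w', hw, hw'⟩ := A.reachable_down B n w
    have hzw : z'.1.1 = w'.1.1 := by rw [hz', hw', hmn]
    have h1 := z'.2
    have h2 := w'.2
    rw [hzw] at h1
    obtain ⟨l, hl⟩ := B.exists_common_ancestor (x := z'.1.2) (y := w'.1.2) (by omega)
    exact hz.trans ((A.reachable_of_fst_eq B l z' w' hzw hl).trans hw.symm)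
  nonempty := by
    obtain ⟨x⟩ := A.nonempty
    exact ⟨(B.exists_fst_eq h x).choose⟩

/-! #### Growth -/

/-- The step from a vertex to itself or to one of its neighbors. -/
def step (z : HoroPair h k) : Option (Fin p ⊕ Fin q) → HoroPair h k
  | none => z
  | some (.inl i) => A.upChild B z i
  | some (.inr j) => A.downChild B z j

theorem exists_step_eq {z w : HoroPair h k} (hzw : (A.horoProduct B).Adj z w) :
    ∃ s, A.step B z s = w := by
  rcases hzw with h1 | h1
  · obtain ⟨i, rfl⟩ := h1.exists_eq_upChild
    exact ⟨some (.inl i), rfl⟩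
  · obtain ⟨j, rfl⟩ := h1.exists_eq_downChild
    exact ⟨some (.inr j), rfl⟩

theorem finite_neighborSet (z : HoroPair h k) : ((A.horoProduct B).neighborSet z).Finite :=
  (Set.finite_range (A.step B z)).subset fun _ hw => A.exists_step_eq B hw

/-- Each step has at most `p + q + 1` outcomes, counting the step that stays in place. -/
theorem growth_le (z : HoroPair h k) (r : ℕ) :
    (A.horoProduct B).growth z r ≤ ((p + q + 1 : ℕ) : ℕ∞) ^ r := by
  classical
  have key : ∀ r : ℕ, ∃ F : Finset (HoroPair h k), F.card ≤ (p + q + 1) ^ r ∧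
      ∀ w (l : (A.horoProduct B).Walk w z), l.length ≤ r → w ∈ F := by
    intro r
    induction r with
    | zero =>
      refine ⟨{z}, by simp, fun w l hl => ?_⟩
      cases l with
      | nil => simp
      | cons _ _ => simp at hl
    | succ r ih =>
      obtain ⟨F, hF, hFw⟩ := ih
      refine ⟨F.biUnion fun w => Finset.univ.image (A.step B w), ?_, fun w l hl => ?_⟩
      · refine (Finset.card_biUnion_le_card_mul F _ (p + q + 1) fun w _ => ?_).trans ?_
        · exact Finset.card_image_le.trans (by simp [Fintype.card_sum])
        · rw [pow_succ]
          exact Nat.mul_le_mul_right _ hF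
      · simp only [Finset.mem_biUnion, Finset.mem_image, Finset.mem_univ, true_and]
        cases l with
        | nil => exact ⟨_, hFw _ .nil (Nat.zero_le _), none, rfl⟩
        | cons hadj l =>
          rw [SimpleGraph.Walk.length_cons] at hl
          exact ⟨_, hFw _ l (by omega), A.exists_step_eq B hadj.symm⟩
  obtain ⟨F, hF, hFw⟩ := key r
  calc (A.horoProduct B).growth z r ≤ (F : Set (HoroPair h k)).encard := by
        refine Set.encard_le_encard fun w hw => ?_
        obtain ⟨l, hl⟩ := (A.horoProduct_connected B).exists_walk_length_eq_edist w z
        refine hFw w l ?_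
        have : (l.length : ℕ∞) ≤ r := hl ▸ hw
        exact_mod_cast this
    _ = (F.card : ℕ∞) := Set.encard_coe_eq_coe_finsetCard F
    _ ≤ _ := by exact_mod_cast hF

/-- Going up `r` times leaves `p` free choices each time, and different choices lead to different
first coordinates. -/
theorem le_growth (z : HoroPair h k) (r : ℕ) :
    ((2 ^ r : ℕ) : ℕ∞) ≤ (A.horoProduct B).growth z r := by
  classical
  have key : ∀ r : ℕ, ∃ F : Finset (HoroPair h k), F.card = p ^ r ∧
      ∀ w ∈ F, w.1.2 = B.parent^[r] z.1.2 ∧ (A.horoProduct B).edist w z ≤ r := by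
    intro r
    induction r with
    | zero => exact ⟨{z}, by simp, by simp⟩
    | succ r ih =>
      obtain ⟨F, hF, hFw⟩ := ih
      refine ⟨(F ×ˢ Finset.univ).image fun a => A.upChild B a.1 a.2, ?_, ?_⟩
      · rw [Finset.card_image_of_injOn, Finset.card_product, hF, Finset.card_univ,
          Fintype.card_fin, pow_succ]
        rintro ⟨w, i⟩ hw ⟨w', i'⟩ hw' heq
        simp only [Finset.coe_product, Finset.coe_univ, Set.mem_prod, Finset.mem_coe,
          Set.mem_univ, and_true] at hw hw'
        have h1 : A.child w.1.1 i = A.child w'.1.1 i' := congrArg (fun a => a.1.1) heq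
        have h2 := congrArg A.parent h1
        have h3 := congrArg A.idx h1
        rw [A.parent_child, A.parent_child] at h2
        rw [A.idx_child, A.idx_child] at h3
        refine Prod.ext (Subtype.ext (Prod.ext h2 ?_)) h3
        rw [(hFw w hw).1, (hFw w' hw').1]
      · intro w hw
        simp only [Finset.mem_image, Finset.mem_product, Finset.mem_univ, and_true,
          Prod.exists] at hw
        obtain ⟨u, i, hu, rfl⟩ := hw
        obtain ⟨h1, h2⟩ := hFw u hu
        refine ⟨by simp [upChild, h1, ← Function.iterate_succ_apply' B.parent], ?_⟩
        refine SimpleGraph.edist_triangle.trans (?_ : _ + (A.horoProduct B).edist u z ≤ _)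
        rw [SimpleGraph.edist_eq_one_iff_adj.2 (A.up_upChild B u i).adj_symm, add_comm]
        push_cast
        gcongr
  obtain ⟨F, hF, hFw⟩ := key r
  calc ((2 ^ r : ℕ) : ℕ∞) ≤ (F.card : ℕ∞) := by
        rw [hF]; exact_mod_cast Nat.pow_le_pow_left A.two_le r
    _ = (F : Set (HoroPair h k)).encard := (Set.encard_coe_eq_coe_finsetCard F).symm
    _ ≤ _ := Set.encard_le_encard fun w hw => (hFw w hw).2

theorem symmetricGrowth : (A.horoProduct B).SymmetricGrowth := by
  -- The radius factor comes from `p + q + 1 ≤ 2 ^ (p + q + 1)`, which compares the two exponential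
  -- bounds.
  refine ⟨1, p + q + 1, 0, fun r _ x y => ?_⟩
  rw [Nat.cast_one, one_mul]
  refine (A.growth_le B x r).trans (le_trans ?_ (A.le_growth B y _))
  rw [pow_mul]
  exact_mod_cast Nat.pow_le_pow_left (Nat.lt_two_pow_self).le r

end Product

end HoroTree

namespace HoroTree

/-! ### Displacements -/

section Displacement

variable {V : Type*} {h : V → ℤ} {p : ℕ} (A : HoroTree h p) {X : Type*} {G : SimpleGraph X}
  {π : X → V}

/-- A walk shorter than `N` would yield a common ancestor fewer than `N` generations back; equal
heights put it at the same distance from both vertices, so the `N`-th ancestors would agree. -/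
theorem le_edist_of_iterate_ne (hπ : ∀ z w, G.Adj z w → A.parent (π z) = π w ∨ A.parent (π w) = π z)
    {z w : X} (hh : h (π z) = h (π w)) {N : ℕ}
    (hN : A.parent^[N] (π z) ≠ A.parent^[N] (π w)) : (N : ℕ∞) ≤ G.edist z w := by
  by_contra! hlt
  obtain ⟨r, hr⟩ := SimpleGraph.exists_walk_of_edist_ne_top hlt.ne_top
  rw [← hr, Nat.cast_lt] at hlt
  obtain ⟨a, b, ha, hb, hab⟩ := A.exists_iterate_of_walk π hπ r
  have h1 := congrArg h hab
  rw [A.height_parent_iterate, A.height_parent_iterate] at h1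
  obtain rfl : a = b := by omega
  obtain ⟨c, rfl⟩ : ∃ c, N = c + a := ⟨N - a, by omega⟩
  exact hN (by rw [Function.iterate_add_apply, hab, Function.iterate_add_apply])

theorem le_edist_of_height
    (hπ : ∀ z w, G.Adj z w → A.parent (π z) = π w ∨ A.parent (π w) = π z)
    {z w : X} {N : ℕ} (hN : (N : ℤ) ≤ h (π z) - h (π w)) : (N : ℕ∞) ≤ G.edist z w := by
  by_contra! hlt
  obtain ⟨r, hr⟩ := SimpleGraph.exists_walk_of_edist_ne_top hlt.ne_top
  rw [← hr, Nat.cast_lt] at hlt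
  obtain ⟨a, b, ha, hb, hab⟩ := A.exists_iterate_of_walk π hπ r
  have h1 := congrArg h hab
  rw [A.height_parent_iterate, A.height_parent_iterate] at h1
  omega

/-- If a map acts non-trivially on a tree coordinate, preserving heights and parents, then its
displacement is unbounded: go down from a vertex of the tree that is moved. -/
theorem exists_le_edist_of_map_ne
    (hπ : ∀ z w, G.Adj z w → A.parent (π z) = π w ∨ A.parent (π w) = π z)
    (hsurj : Function.Surjective π) {f : X → X} {g : V → V} (hf : ∀ z, π (f z) = g (π z))
    (hg : ∀ v, g (A.parent v) = A.parent (g v)) (hh : ∀ v, h (g v) = h v) {v : V}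
    (hv : g v ≠ v) (N : ℕ) : ∃ z, (N : ℕ∞) ≤ G.edist z (f z) := by
  obtain ⟨z, hz⟩ := hsurj (A.firstChild^[N] v)
  refine ⟨z, A.le_edist_of_iterate_ne hπ (by rw [hf, hh]) ?_⟩
  rw [hf, hz, ← map_parent_iterate A hg, A.parent_iterate_firstChild_iterate]
  exact hv.symm

end Displacement

/-! ### Maps that respect the orientation -/

variable {V W V' W' : Type*} {h : V → ℤ} {k : W → ℤ} {h' : V' → ℤ} {k' : W' → ℤ} {p q p' q' : ℕ}

/-- A bijection between two horocyclic products that respects the orientation of the edges. -/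
structure UpIso (A : HoroTree h p) (B : HoroTree k q) (A' : HoroTree h' p')
    (B' : HoroTree k' q') extends HoroPair h k ≃ HoroPair h' k' where
  up_iff : ∀ z w, A'.Up B' (toFun z) (toFun w) ↔ A.Up B z w

namespace UpIso

variable {A : HoroTree h p} {B : HoroTree k q} {A' : HoroTree h' p'} {B' : HoroTree k' q'}
  (F : UpIso A B A' B')

/-- The same map with the coordinates exchanged on both sides. -/
def swap : UpIso B A B' A' where
  toEquiv := (HoroPair.swap.trans F.toEquiv).trans HoroPair.swap
  up_iff z w :=
    ⟨fun hu => ((F.up_iff (HoroPair.swap w) (HoroPair.swap z)).1 hu.swap).swap,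
      fun hu => ((F.up_iff (HoroPair.swap w) (HoroPair.swap z)).2 hu.swap).swap⟩

/-- Climbing from both vertices through the same children eventually merges them. Going back, the
first coordinate of each image is the parent of the next one, so equality is inherited. -/
theorem fst_congr {z w : HoroPair h k} (hzw : z.1.1 = w.1.1) :
    (F.toEquiv z).1.1 = (F.toEquiv w).1.1 := by
  have h1 := z.2
  have h2 := w.2
  rw [hzw] at h1
  obtain ⟨n, hn⟩ := B.exists_common_ancestor (x := z.1.2) (y := w.1.2) (by omega)
  clear h1 h2
  induction n generalizing z w with
  | zero =>
    obtain rfl : z = w := Subtype.ext (Prod.ext hzw hn)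
    rfl
  | succ n ih =>
    have i : Fin p := ⟨0, by have := A.two_le; omega⟩
    have h1 := ((F.up_iff _ _).2 (A.up_upChild B z i)).1
    have h2 := ((F.up_iff _ _).2 (A.up_upChild B w i)).1
    have h3 := ih (z := A.upChild B z i) (w := A.upChild B w i) (by simp [upChild, hzw])
      (by simpa [upChild] using hn)
    exact h1.symm.trans ((congrArg A'.parent h3).trans h2)

/-- The action on the first coordinate. -/
noncomputable def fstMap (x : V) : V' := (F.toEquiv (B.exists_fst_eq h x).choose).1.1

theorem fst_apply (z : HoroPair h k) : (F.toEquiv z).1.1 = F.fstMap z.1.1 :=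
  F.fst_congr (B.exists_fst_eq h z.1.1).choose_spec.symm

theorem snd_apply (z : HoroPair h k) : (F.toEquiv z).1.2 = F.swap.fstMap z.1.2 :=
  F.swap.fst_apply (HoroPair.swap z)

theorem fstMap_parent (x : V) : F.fstMap (A.parent x) = A'.parent (F.fstMap x) := by
  obtain ⟨z, rfl⟩ := B.exists_fst_eq h x
  obtain ⟨w, hw⟩ := A.exists_down B z
  rw [hw.1, ← F.fst_apply, ← F.fst_apply]
  exact (((F.up_iff _ _).2 hw).1).symm

theorem exists_fstMap_eq (v : V) (u' : V') (hu' : A'.parent u' = F.fstMap v) :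
    ∃ u, A.parent u = v ∧ F.fstMap u = u' := by
  obtain ⟨z, rfl⟩ := B.exists_fst_eq h v
  have h1 := A'.up_upChild B' (F.toEquiv z) (A'.idx u')
  rw [← F.toEquiv.apply_symm_apply (A'.upChild B' (F.toEquiv z) (A'.idx u'))] at h1
  refine ⟨_, ((F.up_iff _ _).1 h1).1, ?_⟩
  rw [← F.fst_apply, F.toEquiv.apply_symm_apply]
  change A'.child (F.toEquiv z).1.1 _ = _
  rw [F.fst_apply, ← hu', A'.child_idx]

/-- Siblings have equal heights, so both can be paired with the same second coordinate; injectivity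
on pairs then applies. -/
theorem fstMap_inj_on_children (u w : V) (huw : A.parent u = A.parent w)
    (he : F.fstMap u = F.fstMap w) : u = w := by
  obtain ⟨z, rfl⟩ := B.exists_fst_eq h u
  have h1 := A.height_parent z.1.1
  have h2 := A.height_parent w
  rw [huw] at h1
  have h3 := z.2
  let z' : HoroPair h k := ⟨(w, z.1.2), by simp only; omega⟩
  have : F.toEquiv z = F.toEquiv z' := by
    refine Subtype.ext (Prod.ext ?_ ?_)
    · rw [F.fst_apply, F.fst_apply, he]
    · rw [F.snd_apply, F.snd_apply]
  exact congrArg (fun a => a.1.1) (F.toEquiv.injective this)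

theorem exists_shift : ∃ c : ℤ, ∀ v, h' (F.fstMap v) = h v + c :=
  A.exists_shift F.fstMap_parent

/-- If the sums of the colors of the coordinates change by an amount that depends only on the
height, then the colors of the first coordinates do not change. -/
theorem color_fstMap {e : ℤ → ZMod 2}
    (he : ∀ z : HoroPair h k, A'.color (F.toEquiv z).1.1 + B'.color (F.toEquiv z).1.2 =
      A.color z.1.1 + B.color z.1.2 + e (h z.1.1)) (v : V) :
    A'.color (F.fstMap v) = A.color v := by
  refine A.color_map_eq F.exists_fstMap_eq (fun x y hxy => ?_) v
  obtain ⟨z, rfl⟩ := B.exists_fst_eq h x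
  have h1 := z.2
  -- Since `z` and `z'` share the second coordinate and the height, subtraction cancels the second
  -- color and `e`.
  let z' : HoroPair h k := ⟨(y, z.1.2), by simp only; omega⟩
  have e1 := he z
  have e2 := he z'
  rw [F.fst_apply, F.snd_apply] at e1 e2
  simp only [z', ← hxy] at e2
  linear_combination e1 - e2

theorem color_swap_fstMap {e : ℤ → ZMod 2}
    (he : ∀ z : HoroPair h k, A'.color (F.toEquiv z).1.1 + B'.color (F.toEquiv z).1.2 =
      A.color z.1.1 + B.color z.1.2 + e (h z.1.1)) (v : W) :
    B'.color (F.swap.fstMap v) = B.color v := by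
  -- Exchanging the coordinates negates the height on which `e` depends.
  refine F.swap.color_fstMap (e := fun n => e (-n)) (fun z => ?_) v
  have h1 := he (HoroPair.swap z)
  have h2 : h z.1.2 = -k z.1.1 := by have := z.2; omega
  change A'.color (F.toEquiv (HoroPair.swap z)).1.1 + B'.color (F.toEquiv (HoroPair.swap z)).1.2 =
    A.color z.1.2 + B.color z.1.1 + e (h z.1.2) at h1
  rw [h2] at h1
  change B'.color (F.toEquiv (HoroPair.swap z)).1.2 + A'.color (F.toEquiv (HoroPair.swap z)).1.1 =
    B.color z.1.1 + A.color z.1.2 + e (-k z.1.1)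
  linear_combination h1

theorem eq_zero_of_color {e : ℤ → ZMod 2}
    (he : ∀ z : HoroPair h k, A'.color (F.toEquiv z).1.1 + B'.color (F.toEquiv z).1.2 =
      A.color z.1.1 + B.color z.1.2 + e (h z.1.1)) (n : ℤ) : e n = 0 := by
  obtain ⟨v, rfl⟩ := A.exists_height_eq n
  obtain ⟨z, rfl⟩ := B.exists_fst_eq h v
  have h1 := he z
  rw [F.fst_apply, F.snd_apply, F.color_fstMap he, F.color_swap_fstMap he] at h1
  linear_combination -h1

theorem fstMap_eq_self {B' : HoroTree k' q'} (F : UpIso A B A B')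
    (hh : ∀ v, h (F.fstMap v) = h v) (hc : ∀ v, A.color (F.fstMap v) = A.color v) (v : V) :
    F.fstMap v = v :=
  A.map_eq_self F.fstMap_parent hh
    (fun u => Fin.ext (A.idx_map_eq F.fstMap_parent F.exists_fstMap_eq
      F.fstMap_inj_on_children hc u)) v

end UpIso

/-! ### Automorphisms of horocyclic products -/

section Automorphism

variable {A : HoroTree h p} {B : HoroTree k q}

/-- Replacing the second coordinate of `z` by a sibling keeps all upward neighbors. Together with
`Up.eq_of_adj_adj`, this detects by adjacency alone whether two neighbors of `z` lie on the same
side. -/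
theorem Up.exists_adj_adj {z w w' : HoroPair h k} (hw : A.Up B z w) (hw' : A.Up B z w') :
    ∃ z', z' ≠ z ∧ (A.horoProduct B).Adj z' w ∧ (A.horoProduct B).Adj z' w' := by
  obtain ⟨y, hy, hyp⟩ := B.exists_sibling z.1.2
  have h1 := B.height_parent y
  have h2 := B.height_parent z.1.2
  have h3 := z.2
  rw [hyp] at h1
  refine ⟨⟨(z.1.1, y), by simp only; omega⟩, fun he => hy (congrArg (fun a => a.1.2) he), ?_, ?_⟩
  · exact Up.adj ⟨hw.1, hyp.trans hw.2⟩
  · exact Up.adj ⟨hw'.1, hyp.trans hw'.2⟩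

theorem Up.exists_adj_adj' {z w w' : HoroPair h k} (hw : A.Up B w z) (hw' : A.Up B w' z) :
    ∃ z', z' ≠ z ∧ (A.horoProduct B).Adj z' w ∧ (A.horoProduct B).Adj z' w' := by
  obtain ⟨z', hz', h1, h2⟩ := hw.swap.exists_adj_adj hw'.swap
  refine ⟨HoroPair.swap z', fun he => hz' (he ▸ rfl), ?_, ?_⟩
  · exact h1.symm.imp Up.swap Up.swap
  · exact h2.symm.imp Up.swap Up.swap

/-- By heights `z'` lies between `w'` and `w`, so its first coordinate is the parent of that of `w`
and its second the parent of that of `w'`. -/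
theorem Up.eq_of_adj_adj {z w w' z' : HoroPair h k} (hw : A.Up B z w) (hw' : A.Up B w' z)
    (h1 : (A.horoProduct B).Adj z' w) (h2 : (A.horoProduct B).Adj z' w') : z' = z := by
  have e1 := hw.height
  have e2 := hw'.height
  rcases h1 with h1 | h1
  · rcases h2 with h2 | h2
    · have := h1.height; have := h2.height; omega
    · exact Subtype.ext (Prod.ext (h1.1.symm.trans hw.1) (h2.2.symm.trans hw'.2))
  · have := h1.height
    rcases h2 with h2 | h2 <;> · have := h2.height; omega

variable (f : A.horoProduct B ≃g A.horoProduct B)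

/-- At each vertex, an automorphism either preserves or reverses the orientation. -/
theorem preserves_or_reverses_at (z : HoroPair h k) :
    ((∀ w, A.Up B z w → A.Up B (f z) (f w)) ∧ ∀ w, A.Up B w z → A.Up B (f w) (f z)) ∨
    ((∀ w, A.Up B z w → A.Up B (f w) (f z)) ∧ ∀ w, A.Up B w z → A.Up B (f z) (f w)) := by
  have same : ∀ w w', (∃ z', z' ≠ z ∧ (A.horoProduct B).Adj z' w ∧ (A.horoProduct B).Adj z' w') →
      A.Up B (f z) (f w) → ¬ A.Up B (f w') (f z) := by
    rintro w w' ⟨z', hz', h1, h2⟩ hw hw'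
    exact hz' (f.injective (hw.eq_of_adj_adj hw' (f.map_adj_iff.2 h1) (f.map_adj_iff.2 h2)))
  have diff : ∀ w w', A.Up B z w → A.Up B w' z →
      ¬ ∃ z', z' ≠ f z ∧ (A.horoProduct B).Adj z' (f w) ∧ (A.horoProduct B).Adj z' (f w') := by
    rintro w w' hw hw' ⟨z', hz', h1, h2⟩
    rw [← f.apply_symm_apply z'] at h1 h2
    refine hz' ?_
    rw [← f.apply_symm_apply z', hw.eq_of_adj_adj hw' (f.map_adj_iff.1 h1) (f.map_adj_iff.1 h2)]
  obtain ⟨w₀, hw₀⟩ := A.exists_up B z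
  have hadj : ∀ w, A.Up B z w → A.Up B (f z) (f w) ∨ A.Up B (f w) (f z) :=
    fun w hw => f.map_adj_iff.2 hw.adj
  have hadj' : ∀ w, A.Up B w z → A.Up B (f z) (f w) ∨ A.Up B (f w) (f z) :=
    fun w hw => f.map_adj_iff.2 hw.adj_symm
  rcases hadj w₀ hw₀ with h0 | h0
  · left
    refine ⟨fun w hw => (hadj w hw).resolve_right (same w₀ w (hw₀.exists_adj_adj hw) h0),
      fun w hw => (hadj' w hw).resolve_left fun h1 => ?_⟩
    exact diff w₀ w hw₀ hw (h0.exists_adj_adj h1)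
  · right
    refine ⟨fun w hw => (hadj w hw).resolve_left fun h1 =>
      same w w₀ (hw.exists_adj_adj hw₀) h1 h0, fun w hw => (hadj' w hw).resolve_right fun h1 => ?_⟩
    exact diff w₀ w hw₀ hw (h0.exists_adj_adj' h1)

/-- An automorphism either preserves or reverses the orientation of all edges. -/
theorem preserves_or_reverses :
    (∀ z w, A.Up B z w → A.Up B (f z) (f w)) ∨ ∀ z w, A.Up B z w → A.Up B (f w) (f z) := by
  -- The edge between `z` and `w` is seen from both ends, so its direction forces the same behavior
  -- at `w`; connectedness then spreads it.
  have hstep : ∀ z w, (A.horoProduct B).Adj z w → (∀ u, A.Up B z u → A.Up B (f z) (f u)) →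
      (∀ u, A.Up B w u → A.Up B (f w) (f u)) := by
    intro z w hzw hz
    have hz' : ∀ u, A.Up B u z → A.Up B (f u) (f z) := by
      rcases preserves_or_reverses_at f z with h1 | h1
      · exact h1.2
      · obtain ⟨u, hu⟩ := A.exists_up B z
        exact absurd (hz u hu) (h1.1 u hu).not_symm
    rcases preserves_or_reverses_at f w with h1 | h1
    · exact h1.1
    · rcases hzw with h2 | h2
      · exact absurd (hz w h2) (h1.2 z h2).not_symm
      · exact absurd (hz' w h2) (h1.1 z h2).not_symm
  by_cases hex : ∃ z, ∀ u, A.Up B z u → A.Up B (f z) (f u)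
  · left
    obtain ⟨z, hz⟩ := hex
    intro w
    obtain ⟨r⟩ := (A.horoProduct_connected B).preconnected z w
    induction r with
    | nil => exact hz
    | cons hadj r ih => exact ih (hstep _ _ hadj hz)
  · right
    intro z
    rcases preserves_or_reverses_at f z with h1 | h1
    · exact absurd ⟨z, h1.1⟩ hex
    · exact h1.1

variable {f}

/-- An automorphism that preserves the orientation. -/
def upIsoOfPreserves (hf : ∀ z w, A.Up B z w → A.Up B (f z) (f w)) : UpIso A B A B where
  toEquiv := f.toEquiv
  up_iff z w := by
    refine ⟨fun hu => ?_, hf z w⟩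
    rcases f.map_adj_iff.1 (Or.inl hu : (A.horoProduct B).Adj (f z) (f w)) with h1 | h1
    · exact h1
    · exact absurd hu (hf _ _ h1).not_symm

/-- An automorphism that reverses the orientation, followed by the exchange of the coordinates. -/
def upIsoOfReverses (hf : ∀ z w, A.Up B z w → A.Up B (f w) (f z)) : UpIso A B B A where
  toEquiv := f.toEquiv.trans HoroPair.swap
  up_iff z w := by
    refine ⟨fun hu => ?_, fun hu => (hf z w hu).swap⟩
    have hu' : A.Up B (f w) (f z) := hu.swap
    rcases f.map_adj_iff.1 (Or.inl hu' : (A.horoProduct B).Adj (f w) (f z)) with h1 | h1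
    · exact absurd hu' (hf _ _ h1).not_symm
    · exact h1

/-- A non-trivial automorphism with a fixed vertex has unbounded displacement. -/
theorem exists_le_edist {z₀ : HoroPair h k} (hz₀ : f z₀ = z₀) (hf : f ≠ 1) (N : ℕ) :
    ∃ z, (N : ℕ∞) ≤ (A.horoProduct B).edist z (f z) := by
  have hfst : ∀ z w, (A.horoProduct B).Adj z w →
      A.parent z.1.1 = w.1.1 ∨ A.parent w.1.1 = z.1.1 := fun _ _ => A.adj_fst B
  rcases preserves_or_reverses f with ho | ho
  · let F := upIsoOfPreserves ho
    have hF1 : ∀ z, (f z).1.1 = F.fstMap z.1.1 := F.fst_apply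
    have hF2 : ∀ z, (f z).1.2 = F.swap.fstMap z.1.2 := F.snd_apply
    have hh1 : ∀ v, h (F.fstMap v) = h v := by
      obtain ⟨c, hc⟩ := F.exists_shift
      have := hc z₀.1.1
      rw [← hF1, hz₀] at this
      intro v
      rw [hc v]; omega
    have hh2 : ∀ v, k (F.swap.fstMap v) = k v := by
      obtain ⟨c, hc⟩ := F.swap.exists_shift
      have := hc z₀.1.2
      rw [← hF2, hz₀] at this
      intro v
      rw [hc v]; omega
    by_cases h1 : ∃ v, F.fstMap v ≠ v
    · obtain ⟨v, hv⟩ := h1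
      exact A.exists_le_edist_of_map_ne hfst (B.exists_fst_eq h) hF1 F.fstMap_parent hh1 hv N
    by_cases h2 : ∃ v, F.swap.fstMap v ≠ v
    · obtain ⟨v, hv⟩ := h2
      refine B.exists_le_edist_of_map_ne (π := fun z : HoroPair h k => z.1.2) ?_ ?_ hF2
        F.swap.fstMap_parent hh2 hv N
      · rintro z w (hzw | hzw)
        · exact Or.inl hzw.2
        · exact Or.inr hzw.2
      · intro y
        obtain ⟨z, hz⟩ := A.exists_fst_eq k y
        exact ⟨HoroPair.swap z, hz⟩
    push Not at h1 h2
    refine absurd (RelIso.ext fun z => Subtype.ext (Prod.ext ?_ ?_)) hf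
    · rw [hF1, h1]; rfl
    · rw [hF2, h2]; rfl
  · let F := upIsoOfReverses ho
    have hF : ∀ z, (f z).1.2 = F.fstMap z.1.1 := F.fst_apply
    obtain ⟨c, hc⟩ := F.exists_shift
    -- The image of `z` has height `-(h z.1.1 + c)`, so the heights differ by `2 * h z.1.1 + c`,
    -- which is at least `N` here.
    obtain ⟨v, hv⟩ := A.exists_height_eq (N + |c|)
    obtain ⟨z, rfl⟩ := B.exists_fst_eq h v
    refine ⟨z, A.le_edist_of_height hfst ?_⟩
    have h1 := hc z.1.1
    rw [← hF] at h1
    have h2 := (f z).2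
    have := neg_abs_le c
    have := abs_nonneg c
    omega

theorem infinite_moved (hf : f ≠ 1) : {z | f z ≠ z}.Infinite := by
  intro hfin
  -- Heights are unbounded, so finitely many moved vertices cannot be all vertices.
  have hex : ∃ z₀, f z₀ = z₀ := by
    by_contra! hne
    have huniv : {z | f z ≠ z} = Set.univ := Set.eq_univ_of_forall hne
    rw [huniv] at hfin
    obtain ⟨N, hN⟩ := (hfin.image fun z => h z.1.1).bddAbove
    obtain ⟨v, hv⟩ := A.exists_height_eq (N + 1)
    obtain ⟨z, rfl⟩ := B.exists_fst_eq h v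
    have := hN ⟨z, Set.mem_univ _, rfl⟩
    simp only at this
    omega
  obtain ⟨z₀, hz₀⟩ := hex
  obtain ⟨N, hN⟩ := (hfin.image fun z => (A.horoProduct B).dist z (f z)).bddAbove
  obtain ⟨z, hz⟩ := exists_le_edist hz₀ hf (N + 1)
  rw [← ((A.horoProduct_connected B) z (f z)).coe_dist_eq_edist, Nat.cast_le] at hz
  by_cases hfz : f z = z
  · rw [hfz, SimpleGraph.dist_self] at hz
    omega
  · have := hN ⟨z, hfz, rfl⟩
    simp only at this
    omega

/-! ### Motion and the distinguishing coloring -/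

variable (A B)

theorem motion_univ :
    SimpleGraph.motion (Set.univ : Set (A.horoProduct B ≃g A.horoProduct B)) = ⊤ := by
  simp only [SimpleGraph.motion, iInf_eq_top]
  rintro f ⟨-, hf⟩
  exact Set.encard_eq_top_iff.2 (infinite_moved hf)

theorem geometricMotion_vertexStabilizer (z₀ : HoroPair h k) :
    SimpleGraph.geometricMotion ((A.horoProduct B).vertexStabilizer z₀) = ⊤ := by
  simp only [SimpleGraph.geometricMotion, iInf_eq_top]
  rintro f ⟨hz₀, hf⟩
  refine ENat.eq_top_iff_forall_ge.2 fun N => ?_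
  obtain ⟨z, hz⟩ := exists_le_edist hz₀ hf N
  exact hz.trans (le_iSup (fun z => (A.horoProduct B).edist z (f z)) z)

/-- The sum of the colors of the coordinates, with the colors exchanged at the vertices of
non-negative height. -/
def pairColor (z : HoroPair h k) : Fin 2 :=
  show ZMod 2 from A.color z.1.1 + B.color z.1.2 + if 0 ≤ h z.1.1 then 1 else 0

theorem isDistinguishing_pairColor : (A.horoProduct B).IsDistinguishing (A.pairColor B) := by
  intro f hf
  have hf' : ∀ z, A.color (f z).1.1 + B.color (f z).1.2 + (if 0 ≤ h (f z).1.1 then 1 else 0) =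
      A.color z.1.1 + B.color z.1.2 + if 0 ≤ h z.1.1 then 1 else 0 := hf
  have hsub : ∀ a : ZMod 2, a + a = 0 := by decide
  rcases preserves_or_reverses f with ho | ho
  · let F := upIsoOfPreserves ho
    have hF1 : ∀ z, (f z).1.1 = F.fstMap z.1.1 := F.fst_apply
    have hF2 : ∀ z, (f z).1.2 = F.swap.fstMap z.1.2 := F.snd_apply
    obtain ⟨c, hc⟩ := F.exists_shift
    let e : ℤ → ZMod 2 := fun n => (if 0 ≤ n then 1 else 0) + if 0 ≤ n + c then 1 else 0
    have he : ∀ z : HoroPair h k, A.color (F.toEquiv z).1.1 + B.color (F.toEquiv z).1.2 =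
        A.color z.1.1 + B.color z.1.2 + e (h z.1.1) := by
      intro z
      have h1 := hf' z
      rw [hF1 z, hc, ← hF1 z] at h1
      change A.color (f z).1.1 + B.color (f z).1.2 = _
      simp only [e]
      linear_combination h1 - hsub (if 0 ≤ h z.1.1 + c then 1 else 0)
    -- For `c ≠ 0` the indicators of `0 ≤ n` and `0 ≤ n + c` differ at `n = 0` if `c < 0`, and at `n
    -- = -c` if `c > 0`.
    have hc0 : c = 0 := by
      have e0 := F.eq_zero_of_color he 0
      have e1 := F.eq_zero_of_color he (-c)
      simp only [e] at e0 e1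
      by_contra hne
      rcases lt_or_gt_of_ne hne with h1 | h1
      · rw [if_pos le_rfl, if_neg (by omega)] at e0
        exact absurd e0 (by decide)
      · rw [if_neg (by omega), if_pos (by omega)] at e1
        exact absurd e1 (by decide)
    have hh2 : ∀ y, k (F.swap.fstMap y) = k y := by
      intro y
      obtain ⟨z, rfl⟩ : ∃ z : HoroPair h k, z.1.2 = y := by
        obtain ⟨z, hz⟩ := A.exists_fst_eq k y
        exact ⟨HoroPair.swap z, hz⟩
      have h1 := (f z).2
      have h2 := z.2
      rw [hF1, hc] at h1
      rw [← hF2]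
      omega
    refine RelIso.ext fun z => Subtype.ext (Prod.ext ?_ ?_)
    · rw [hF1]
      exact F.fstMap_eq_self (fun v => by rw [hc, hc0, add_zero]) (F.color_fstMap he) _
    · rw [hF2]
      exact F.swap.fstMap_eq_self hh2 (F.color_swap_fstMap he) _
  · let F := upIsoOfReverses ho
    have hF : ∀ z, (f z).1.2 = F.fstMap z.1.1 := F.fst_apply
    obtain ⟨c, hc⟩ := F.exists_shift
    let e : ℤ → ZMod 2 := fun n => (if 0 ≤ n then 1 else 0) + if 0 ≤ -(n + c) then 1 else 0
    have he : ∀ z : HoroPair h k, B.color (F.toEquiv z).1.1 + A.color (F.toEquiv z).1.2 =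
        A.color z.1.1 + B.color z.1.2 + e (h z.1.1) := by
      intro z
      have h1 := hf' z
      have h2 : h (f z).1.1 = -(h z.1.1 + c) := by
        have := (f z).2
        rw [hF, hc] at this
        omega
      rw [h2] at h1
      change B.color (f z).1.2 + A.color (f z).1.1 = _
      simp only [e]
      linear_combination h1 - hsub (if 0 ≤ -(h z.1.1 + c) then 1 else 0)
    -- At this height the vertex has nonnegative height and its image negative height, so the
    -- indicator changes, a contradiction.
    have e0 := F.eq_zero_of_color he (|c| + 1)
    have := neg_abs_le c
    have := abs_nonneg c
    simp only [e] at e0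
    rw [if_pos (by omega), if_neg (by omega)] at e0
    exact absurd e0 (by decide)

theorem distinguishingNumber_le_two : (A.horoProduct B).distinguishingNumber ≤ 2 :=
  iInf₂_le 2 ⟨A.pairColor B, A.isDistinguishing_pairColor B⟩

end Automorphism

end HoroTree

/-! ### From regular trees with an end to parents and children -/

namespace SimpleGraph

variable {V : Type*} {T : SimpleGraph V}

/-- In a tree, at most one neighbor of a vertex is closer to a given vertex. -/
theorem IsTree.eq_of_dist_add_one_eq (hT : T.IsTree) {r x y z : V} (hy : T.Adj x y)
    (hz : T.Adj x z) (hyr : T.dist y r + 1 = T.dist x r) (hzr : T.dist z r + 1 = T.dist x r) :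
    y = z := by
  obtain ⟨a, ha⟩ := hT.connected.exists_walk_length_eq_dist y r
  obtain ⟨b, hb⟩ := hT.connected.exists_walk_length_eq_dist z r
  have h1 : (Walk.cons hy a).IsPath :=
    Walk.isPath_of_length_eq_dist _ (by rw [Walk.length_cons, ha, hyr])
  have h2 : (Walk.cons hz b).IsPath :=
    Walk.isPath_of_length_eq_dist _ (by rw [Walk.length_cons, hb, hzr])
  have := congrArg Walk.snd ((hT.existsUnique_path x r).unique h1 h2)
  simpa using this

/-- In a tree, every vertex other than `r` has a neighbor that is closer to `r`. -/
theorem Connected.exists_adj_dist_add_one_eq (hT : T.Connected) {r x : V} (hxr : x ≠ r) :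
    ∃ y, T.Adj x y ∧ T.dist y r + 1 = T.dist x r := by
  obtain ⟨a, ha⟩ := hT.exists_walk_length_eq_dist x r
  cases a with
  | nil => exact absurd rfl hxr
  | @cons _ y _ hadj a =>
    refine ⟨y, hadj, ?_⟩
    rw [Walk.length_cons] at ha
    have h1 := dist_le a
    have h2 := hT.dist_triangle (u := x) (v := y) (w := r)
    rw [dist_eq_one_iff_adj.2 hadj] at h2
    omega

theorem GeodesicRay.eventually_ne (γ : T.GeodesicRay) (x : V) :
    ∀ᶠ n in atTop, x ≠ γ.vert n := by
  filter_upwards [eventually_gt_atTop (T.dist x (γ.vert 0))] with n hn hx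
  have := γ.dist_vert 0 n
  rw [zero_add, dist_comm, ← hx] at this
  omega

/-- Around each vertex, the Busemann function is the distance from a suitable vertex, up to a
constant. -/
theorem IsTree.exists_busemann_eq_dist [T.LocallyFinite] (hT : T.IsTree) (o : V) (ω : T.TreeEnd)
    (x : V) : ∃ (r : V) (c : ℤ), x ≠ r ∧ T.busemann o ω x = T.dist x r + c ∧
      ∀ y, T.Adj x y → T.busemann o ω y = T.dist y r + c := by
  induction ω using Quotient.inductionOn with
  | h γ =>
    -- As `x` has finitely many neighbors, one far vertex of the ray serves them all.
    have h1 : ∀ᶠ n in atTop, ∀ y ∈ T.neighborFinset x,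
        (T.dist y (γ.vert n) : ℤ) - (T.dist o (γ.vert n) : ℤ) =
          T.busemann o (Quotient.mk _ γ) y :=
      (Filter.eventually_all_finset _).2 fun y _ => eventually_eq_busemann hT.connected o γ y
    obtain ⟨n, hn, hx, hne⟩ :=
      (h1.and ((eventually_eq_busemann hT.connected o γ x).and (γ.eventually_ne x))).exists
    refine ⟨γ.vert n, -T.dist o (γ.vert n), hne, by rw [← hx]; ring, fun y hy => ?_⟩
    rw [← hn y (by simpa using hy)]
    ring

theorem IsTree.busemann_of_adj [T.LocallyFinite] (hT : T.IsTree) (o : V) (ω : T.TreeEnd)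
    {x y : V} (hxy : T.Adj x y) : T.busemann o ω y = T.busemann o ω x - 1 ∨
      T.busemann o ω y = T.busemann o ω x + 1 := by
  obtain ⟨r, c, -, hx, hy⟩ := hT.exists_busemann_eq_dist o ω x
  rw [hx, hy y hxy]
  have := hT.dist_eq_dist_add_one_of_adj r hxy
  rw [T.dist_comm (u := r), T.dist_comm (u := r)] at this
  omega

/-- Near `x` the height is a distance to some `r ≠ x` up to a constant, and in a tree exactly one
neighbor is closer to `r`. -/
theorem IsTree.existsUnique_parent [T.LocallyFinite] (hT : T.IsTree) (o : V) (ω : T.TreeEnd)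
    (x : V) : ∃! y, T.Adj x y ∧ T.busemann o ω y = T.busemann o ω x - 1 := by
  obtain ⟨r, c, hne, hx, hy⟩ := hT.exists_busemann_eq_dist o ω x
  obtain ⟨y, hxy, hyr⟩ := hT.connected.exists_adj_dist_add_one_eq hne
  refine ⟨y, ⟨hxy, by rw [hx, hy y hxy]; omega⟩, fun z ⟨hxz, hz⟩ => ?_⟩
  rw [hx, hy z hxz] at hz
  exact hT.eq_of_dist_add_one_eq hxz hxy (by omega) hyr

/-- A regular tree with an end, as a tree hanging down from this end. -/
theorem IsTree.exists_horoTree [T.LocallyFinite] (hT : T.IsTree) (o : V) (ω : T.TreeEnd) {p : ℕ}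
    (hp : 2 ≤ p) (hreg : T.IsRegularOfDegree (p + 1)) :
    ∃ A : HoroTree (T.busemann o ω) p, ∀ x y, T.Adj x y ↔ A.parent x = y ∨ A.parent y = x := by
  classical
  choose par hpar huniq using hT.existsUnique_parent o ω
  have hadj : ∀ x y, T.Adj x y ↔ par x = y ∨ par y = x := by
    refine fun x y => ⟨fun hxy => ?_, ?_⟩
    · rcases hT.busemann_of_adj o ω hxy with h1 | h1
      · exact Or.inl (huniq x y ⟨hxy, h1⟩).symm
      · exact Or.inr (huniq y x ⟨hxy.symm, by omega⟩).symm
    · rintro (rfl | rfl)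
      · exact (hpar x).1
      · exact (hpar y).1.symm
  have hchild : ∀ x u, u ∈ (T.neighborFinset x).erase (par x) ↔ par u = x := by
    intro x u
    rw [Finset.mem_erase, mem_neighborFinset, hadj]
    refine ⟨fun hu => hu.2.resolve_left hu.1.symm, fun hu => ⟨?_, Or.inr hu⟩⟩
    rintro rfl
    have h1 := (hpar (par x)).2
    have h2 := (hpar x).2
    rw [hu] at h1
    omega
  have hcard : ∀ x, ((T.neighborFinset x).erase (par x)).card = p := by
    intro x
    rw [Finset.card_erase_of_mem (by simpa using (hpar x).1), card_neighborFinset_eq_degree,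
      hreg.degree_eq x, Nat.add_sub_cancel]
  let e : ∀ x, ((T.neighborFinset x).erase (par x)) ≃ Fin p :=
    fun x => Finset.equivFinOfCardEq (hcard x)
  have hpc : ∀ v i, par ((e v).symm i) = v := fun v i => (hchild _ _).1 ((e v).symm i).2
  -- The type of `e (par u)` depends on `par u`; a free `v` allows the substitution `par u = v` that
  -- transports it.
  have hidx : ∀ v u (hu : par u = v),
      e (par u) ⟨u, (hchild _ _).2 rfl⟩ = e v ⟨u, (hchild _ _).2 hu⟩ := by
    rintro v u rfl
    rfl
  refine ⟨⟨par, fun v i => (e v).symm i, fun u => e (par u) ⟨u, (hchild _ _).2 rfl⟩, hp, hpc,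
    fun v i => ?_, fun v => ?_, fun v => (hpar v).2, fun x y => ?_, ⟨o⟩⟩, hadj⟩
  · rw [hidx v _ (hpc v i)]
    exact (e v).apply_symm_apply i
  · simp
  · obtain ⟨r⟩ := hT.connected.preconnected x y
    induction r with
    | nil => exact ⟨0, 0, rfl⟩
    | cons huv r ih =>
      obtain ⟨m, n, hmn⟩ := ih
      rcases (hadj _ _).1 huv with h1 | h1
      · exact ⟨m + 1, n, by rw [Function.iterate_succ_apply, h1, hmn]⟩
      · refine ⟨m, n + 1, ?_⟩
        rw [← h1, ← Function.iterate_succ_apply, Function.iterate_succ_apply', hmn,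
          ← Function.iterate_succ_apply' par]

end SimpleGraph

/-- Moving to the parent in both trees, or to a child in both, would change the sum of the heights
by 2. -/
theorem dlGraph_eq_horoProduct {V W : Type*} {T : SimpleGraph V} {o : V} {ω : T.TreeEnd}
    {T' : SimpleGraph W} {o' : W} {ω' : T'.TreeEnd} {p q : ℕ}
    (A : HoroTree (T.busemann o ω) p) (B : HoroTree (T'.busemann o' ω') q)
    (hA : ∀ x y, T.Adj x y ↔ A.parent x = y ∨ A.parent y = x)
    (hB : ∀ x y, T'.Adj x y ↔ B.parent x = y ∨ B.parent y = x) :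
    DLGraph T o ω T' o' ω' = A.horoProduct B := by
  ext z w
  change T.Adj z.1.1 w.1.1 ∧ T'.Adj z.1.2 w.1.2 ↔ A.Up B z w ∨ A.Up B w z
  rw [hA, hB]
  have hz := z.2
  have hw := w.2
  have a1 := A.height_parent z.1.1
  have a2 := A.height_parent w.1.1
  have b1 := B.height_parent z.1.2
  have b2 := B.height_parent w.1.2
  constructor
  · rintro ⟨h1 | h1, h2 | h2⟩
    · rw [h1] at a1; rw [h2] at b1; omega
    · exact Or.inr ⟨h1, h2⟩
    · exact Or.inl ⟨h1, h2⟩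
    · rw [h1] at a2; rw [h2] at b2; omega
  · rintro (hu | hu)
    · exact ⟨Or.inr hu.1, Or.inl hu.2⟩
    · exact ⟨Or.inl hu.1, Or.inr hu.2⟩

theorem lemma5p2 {V W : Type*} (p q : ℕ) (hp : 2 ≤ p) (hq : 2 ≤ q)
    (T : SimpleGraph V) [T.LocallyFinite] (hT : T.IsTree) (hTp : T.IsRegularOfDegree (p + 1))
    (o : V) (ω : T.TreeEnd)
    (T' : SimpleGraph W) [T'.LocallyFinite] (hT' : T'.IsTree)
    (hTq : T'.IsRegularOfDegree (q + 1)) (o' : W) (ω' : T'.TreeEnd) :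
    -- infinite motion, and infinite geometric motion of the stabilizer of the base vertex
    SimpleGraph.motion (Set.univ : Set (DLGraph T o ω T' o' ω' ≃g DLGraph T o ω T' o' ω')) = ⊤ ∧
    SimpleGraph.geometricMotion
      ((DLGraph T o ω T' o' ω').vertexStabilizer (DLBase T o ω T' o' ω')) = ⊤ ∧
    -- the other properties: connected, locally finite, of symmetric growth
    (DLGraph T o ω T' o' ω').Connected ∧
    (∀ z, ((DLGraph T o ω T' o' ω').neighborSet z).Finite) ∧
    (DLGraph T o ω T' o' ω').SymmetricGrowth ∧
    -- the distinguishing number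
    (DLGraph T o ω T' o' ω').distinguishingNumber ≤ 2 := by
  obtain ⟨A, hA⟩ := hT.exists_horoTree o ω hp hTp
  obtain ⟨B, hB⟩ := hT'.exists_horoTree o' ω' hq hTq
  rw [dlGraph_eq_horoProduct A B hA hB]
  exact ⟨A.motion_univ B, A.geometricMotion_vertexStabilizer B _, A.horoProduct_connected B,
    A.finite_neighborSet B, A.symmetricGrowth B, A.distinguishingNumber_le_two B⟩
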